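/- Let $q,\alpha,a,b\in\mathbb{C}$ with $0<|q|<1$, $a\ne0$, $b\ne0$ and $|\alpha ab/q|<1$. Let $q^{1/3}$ and $\alpha^{1/3}$ denote any fixed cube roots of $q$ and $\alpha$, and write $q^{m/3}=(q^{1/3})^m$ and $\alpha^{m/3}=(\alpha^{1/3})^m$ for integers $m$; in particular $q^{(3n^2-7n)/6}=(q^{1/3})^{(3n^2-7n)/2}$, where $(3n^2-7n)/2$ is an integer. Write $(x;q)_n=\prod_{k=0}^{n-1}(1-xq^k)$ for $n\in\{0,1,2,\dots\}\cup\{\infty\}$ and $(x,y;q)_n=(x;q)_n(y;q)_n$. Suppose that no denominator vanishes, that is, $\alpha q^{k+1}\neq1$, $\alpha aq^k\ne1$ and $\alpha bq^k\neq1$ for all integers $k\ge0$. Then both series below converge absolutely, and \begin{align*} &\frac{(\alpha q,\alpha ab/q;q)_\infty}{(\alpha a,\alpha b;q)_\infty} \sum_{n=0}^\infty\frac{(q/a,q/b;q)_n\,(\alpha^{1/3}q^{1/3};q^{1/3})_{3n}}{(q;q)_n(\alpha q;q)_{2n}}\left(\frac{\alpha ab}{q}\right)^n\\ &\quad=\sum_{n=0}^\infty(-1)^n\,\frac{1-\alpha^{1/3}q^{2n/3}}{1-\alpha^{1/3}}\,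 \frac{(q/a,q/b;q)_n\,(\alpha^{1/3};q^{1/3})_n}{(\alpha a,\alpha b;q)_n\,(q^{1/3};q^{1/3})_n}\,\alpha^{4n/3}a^nb^nq^{(3n^2-7n)/6}. \end{align*} When $\alpha^{1/3}=1$, the factor $\frac{1-\alpha^{1/3}q^{2n/3}}{1-\alpha^{1/3}}\cdot\frac{(\alpha^{1/3};q^{1/3})_n}{(q^{1/3};q^{1/3})_n}$ on the right is understood as its limit, which is $1$ for $n=0$ and $1+q^{n/3}$ for $n\ge1$. -/

import Mathlib

/-- The finite `q`-shifted factorial `(a; q)_n = ∏_{k=0}^{n-1} (1 - a q^k)`. -/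
noncomputable def qShifted (a q : ℂ) (n : ℕ) : ℂ :=
  ∏ k ∈ Finset.range n, (1 - a * q ^ k)

/-- The infinite `q`-shifted factorial `(a; q)_∞ = ∏_{k=0}^{∞} (1 - a q^k)`. -/
noncomputable def qShiftedInf (a q : ℂ) : ℂ :=
  ∏' k : ℕ, (1 - a * q ^ k)

/-- For `|q| < 1` the infinite product `(a; q)_∞` converges, and it is the limit of `(a; q)_n`. -/
theorem tendsto_qShifted (a q : ℂ) (hq : ‖q‖ < 1) :
    Filter.Tendsto (qShifted a q) Filter.atTop (nhds (qShiftedInf a q)) := by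
  have h : Multipliable (fun k : ℕ => 1 + -(a * q ^ k)) := by
    apply multipliable_one_add_of_summable
    simp only [norm_neg, norm_mul, norm_pow]
    exact (summable_geometric_of_lt_one (norm_nonneg q) hq).mul_left _
  simp only [← sub_eq_add_neg] at h
  exact h.hasProd.tendsto_prod_nat

open Filter Topology Finset

/-! The identity is Bailey's lemma applied to a cubic Bailey pair. Put p = q^{1/3}, t = α^{1/3}, A =
q/a, B = q/b, x = αab/q, so that xAB = αq. If β_n = ∑ α_r / ((q;q)_{n-r} (αq;q)_{n+r}), inserting
this into ∑ (A,B;q)_n x^n β_n and exchanging the sums leaves, for each r, a `q`-Gauss series in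
closed form (`tsum_qGaussTerm`); this is `bailey_lemma`.

The pair with β_n = (tp;p)_{3n} / ((q;q)_n (αq;q)_{2n}) is `cubicBaileyPair`. It is a terminating
very-well-poised `₆φ₅` sum in base p (`sum_sixPhiFive`) whose three free parameters differ by cube
roots of unity, so that their products collapse to base p^3 = q.

Both classical summations are proved by telescoping a contiguous relation. Since `wellPoised` has 1
- t cancelled, t = 1 needs no limit argument. -/

theorem qShifted_succ (a q : ℂ) (n : ℕ) :
    qShifted a q (n + 1) = qShifted a q n * (1 - a * q ^ n) :=
  Finset.prod_range_succ _ _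

theorem qShifted_add (a q : ℂ) (m n : ℕ) :
    qShifted a q (m + n) = qShifted a q m * qShifted (a * q ^ m) q n := by
  simp only [qShifted, Finset.prod_range_add, pow_add, mul_assoc]

theorem qShifted_succ' (a q : ℂ) (n : ℕ) :
    qShifted a q (n + 1) = (1 - a) * qShifted (a * q) q n := by
  rw [add_comm, qShifted_add, pow_one]
  simp [qShifted]

theorem qShifted_ne_zero {a q : ℂ} (h : ∀ k : ℕ, a * q ^ k ≠ 1) (n : ℕ) :
    qShifted a q n ≠ 0 :=
  Finset.prod_ne_zero_iff.2 fun k _ => sub_ne_zero.2 (h k).symm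

theorem mul_pow_ne_one_of_norm_lt {x q : ℂ} (hx : ‖x‖ < 1) (hq : ‖q‖ < 1) (k : ℕ) :
    x * q ^ k ≠ 1 := by
  intro h
  have h1 : ‖x * q ^ k‖ < 1 := by
    rw [norm_mul, norm_pow]
    exact (mul_le_of_le_one_right (norm_nonneg x)
      (pow_le_one₀ (norm_nonneg q) hq.le)).trans_lt hx
  rw [h, norm_one] at h1
  exact lt_irrefl _ h1

theorem qShiftedInf_ne_zero {a q : ℂ} (hq : ‖q‖ < 1) (h : ∀ k : ℕ, a * q ^ k ≠ 1) :
    qShiftedInf a q ≠ 0 := by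
  have := tprod_one_add_ne_zero_of_summable (f := fun k : ℕ => -(a * q ^ k))
    (fun k => by rw [← sub_eq_add_neg]; exact sub_ne_zero.2 (h k).symm)
    (by
      simp only [norm_neg, norm_mul, norm_pow]
      exact (summable_geometric_of_lt_one (norm_nonneg q) hq).mul_left _)
  simpa only [qShiftedInf, sub_eq_add_neg] using this

theorem qShiftedInf_eq_mul {a q : ℂ} (hq : ‖q‖ < 1) (n : ℕ) :
    qShiftedInf a q = qShifted a q n * qShiftedInf (a * q ^ n) q := by
  refine tendsto_nhds_unique ((tendsto_qShifted a q hq).comp (tendsto_add_atTop_nat n)) ?_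
  refine ((tendsto_qShifted (a * q ^ n) q hq).const_mul _).congr fun m => ?_
  rw [← qShifted_add, Function.comp_apply, add_comm]

theorem exists_norm_le_of_tendsto {u : ℕ → ℂ} {l : ℂ} (h : Tendsto u atTop (𝓝 l)) :
    ∃ M : ℝ, 0 < M ∧ ∀ n, ‖u n‖ ≤ M := by
  obtain ⟨M, hM⟩ := (Metric.isBounded_range_of_tendsto u h).exists_norm_le
  exact ⟨max M 1, by positivity, fun n => (hM _ ⟨n, rfl⟩).trans (le_max_left _ _)⟩

theorem exists_norm_qShifted_le (a : ℂ) {q : ℂ} (hq : ‖q‖ < 1) :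
    ∃ M : ℝ, 0 < M ∧ ∀ n, ‖qShifted a q n‖ ≤ M :=
  exists_norm_le_of_tendsto (tendsto_qShifted a q hq)

theorem exists_norm_inv_qShifted_le {a q : ℂ} (hq : ‖q‖ < 1) (h : ∀ k : ℕ, a * q ^ k ≠ 1) :
    ∃ M : ℝ, 0 < M ∧ ∀ n, ‖(qShifted a q n)⁻¹‖ ≤ M :=
  exists_norm_le_of_tendsto ((tendsto_qShifted a q hq).inv₀ (qShiftedInf_ne_zero hq h))

/-! ### The `q`-Gauss summation -/

/-- The general term of the series in the `q`-Gauss summation, with `c = x A B`. -/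
noncomputable def qGaussTerm (A B q x : ℂ) (m : ℕ) : ℂ :=
  qShifted A q m * qShifted B q m / (qShifted q q m * qShifted (x * A * B) q m) * x ^ m

/-- The bound is uniform in `N`, as needed for dominated convergence when x is replaced by x q^N. -/
theorem exists_norm_qGaussTerm_le {A B q x : ℂ} (hq : ‖q‖ < 1)
    (h : ∀ k : ℕ, x * A * B * q ^ k ≠ 1) :
    ∃ M : ℝ, 0 < M ∧ ∀ N m, ‖qGaussTerm A B q (x * q ^ N) m‖ ≤ M * ‖x * q ^ N‖ ^ m := by
  obtain ⟨M₁, h₁, H₁⟩ := exists_norm_qShifted_le A hq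
  obtain ⟨M₂, h₂, H₂⟩ := exists_norm_qShifted_le B hq
  obtain ⟨M₃, h₃, H₃⟩ := exists_norm_inv_qShifted_le hq (mul_pow_ne_one_of_norm_lt hq hq)
  obtain ⟨M₄, h₄, H₄⟩ := exists_norm_inv_qShifted_le hq h
  obtain ⟨M₅, h₅, H₅⟩ := exists_norm_qShifted_le (x * A * B) hq
  refine ⟨M₁ * M₂ * (M₃ * (M₄ * M₅)), by positivity, fun N m => ?_⟩
  have e : (qShifted (x * q ^ N * A * B) q m)⁻¹
      = (qShifted (x * A * B) q (N + m))⁻¹ * qShifted (x * A * B) q N := by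
    have hN := qShifted_ne_zero h N
    rw [qShifted_add, mul_inv, show x * A * B * q ^ N = x * q ^ N * A * B by ring]
    field_simp
  rw [qGaussTerm, div_eq_mul_inv, mul_inv, e]
  simp only [norm_mul, norm_pow]
  gcongr
  exacts [H₁ m, H₂ m, H₃ m, H₄ _, H₅ _]

theorem summable_qGaussTerm {A B q x : ℂ} (hq : ‖q‖ < 1) (hx : ‖x‖ < 1)
    (h : ∀ k : ℕ, x * A * B * q ^ k ≠ 1) : Summable (qGaussTerm A B q x) := by
  obtain ⟨M, -, HM⟩ := exists_norm_qGaussTerm_le hq h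
  refine Summable.of_norm_bounded
    ((summable_geometric_of_lt_one (norm_nonneg x) hx).mul_left M) fun m => ?_
  simpa using HM 0 m

theorem qGaussTerm_telescope {A B q x : ℂ} (hq : ‖q‖ < 1)
    (h : ∀ k : ℕ, x * A * B * q ^ k ≠ 1) (m : ℕ) :
    (1 - x * A * B) * (1 - x) * qGaussTerm A B q x m
        - (1 - x * A) * (1 - x * B) * qGaussTerm A B q (x * q) m
      = -(1 - x * A * B) * (1 - q ^ (m + 1)) * qGaussTerm A B q x (m + 1)
        - -(1 - x * A * B) * (1 - q ^ m) * qGaussTerm A B q x m := by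
  have hC := qShifted_ne_zero h m
  have hQ := qShifted_ne_zero (mul_pow_ne_one_of_norm_lt hq hq) m
  have h1 : 1 - x * A * B * q ^ m ≠ 0 := sub_ne_zero.2 (h m).symm
  have h0 : 1 - x * A * B ≠ 0 := by simpa using sub_ne_zero.2 (h 0).symm
  have h2 : 1 - q * q ^ m ≠ 0 := sub_ne_zero.2 (mul_pow_ne_one_of_norm_lt hq hq m).symm
  have e : qShifted (x * q * A * B) q m
      = qShifted (x * A * B) q m * (1 - x * A * B * q ^ m) / (1 - x * A * B) := by
    rw [eq_div_iff h0, ← qShifted_succ, qShifted_succ', mul_comm,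
      show x * A * B * q = x * q * A * B by ring]
  simp only [qGaussTerm, e, qShifted_succ, pow_succ', mul_pow]
  generalize q ^ m = y at *
  have h3 : 1 - y * q ≠ 0 := by rwa [mul_comm]
  field_simp
  ring

theorem tsum_qGaussTerm_contiguous {A B q x : ℂ} (hq : ‖q‖ < 1) (hx : ‖x‖ < 1)
    (h : ∀ k : ℕ, x * A * B * q ^ k ≠ 1) :
    (1 - x * A * B) * (1 - x) * ∑' m, qGaussTerm A B q x m
      = (1 - x * A) * (1 - x * B) * ∑' m, qGaussTerm A B q (x * q) m := by
  have s1 := summable_qGaussTerm hq hx h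
  have hxq : ‖x * q‖ < 1 := by
    rw [norm_mul]; exact mul_lt_one_of_nonneg_of_lt_one_left (norm_nonneg x) hx hq.le
  have s2 : Summable (qGaussTerm A B q (x * q)) := summable_qGaussTerm hq hxq fun k => by
    have := h (k + 1)
    rwa [pow_succ', ← mul_assoc, show x * A * B * q = x * q * A * B by ring] at this
  have hs := (s1.mul_left ((1 - x * A * B) * (1 - x))).hasSum.sub
    (s2.mul_left ((1 - x * A) * (1 - x * B))).hasSum
  have ht := hs.tendsto_sum_nat
  simp only [qGaussTerm_telescope hq h] at ht
  simp only [Finset.sum_range_sub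
    (fun m => -(1 - x * A * B) * (1 - q ^ m) * qGaussTerm A B q x m)] at ht
  -- The antidifference vanishes at 0 through the factor 1 - q^0, and at infinity because the terms
  -- of a convergent series tend to 0.
  have hz : Tendsto (fun m => -(1 - x * A * B) * (1 - q ^ m) * qGaussTerm A B q x m
      - -(1 - x * A * B) * (1 - q ^ 0) * qGaussTerm A B q x 0) atTop (𝓝 0) := by
    have hp := tendsto_pow_atTop_nhds_zero_of_norm_lt_one hq
    simpa using ((hp.const_sub 1).const_mul (-(1 - x * A * B))).mul s1.tendsto_atTop_zero
  have := tendsto_nhds_unique ht hz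
  rw [tsum_mul_left, tsum_mul_left] at this
  exact sub_eq_zero.1 this

/-- The `q`-Gauss summation. -/
theorem tsum_qGaussTerm {A B q x : ℂ} (hq : ‖q‖ < 1) (hx : ‖x‖ < 1)
    (h : ∀ k : ℕ, x * A * B * q ^ k ≠ 1) :
    ∑' m, qGaussTerm A B q x m
      = qShiftedInf (x * A) q * qShiftedInf (x * B) q
        / (qShiftedInf (x * A * B) q * qShiftedInf x q) := by
  have hxN : ∀ N, ‖x * q ^ N‖ < 1 := fun N => by
    rw [norm_mul, norm_pow]
    exact (mul_le_of_le_one_right (norm_nonneg x)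
      (pow_le_one₀ (norm_nonneg q) hq.le)).trans_lt hx
  have hN : ∀ N k : ℕ, x * q ^ N * A * B * q ^ k ≠ 1 := fun N k => by
    have := h (N + k)
    rwa [pow_add, ← mul_assoc, show x * A * B * q ^ N = x * q ^ N * A * B by ring] at this
  -- Iterating x ↦ xq builds up the products; as N → ∞ only the m = 0 term of the remaining series
  -- survives.
  have iter : ∀ N, qShifted (x * A * B) q N * qShifted x q N * ∑' m, qGaussTerm A B q x m
      = qShifted (x * A) q N * qShifted (x * B) q N * ∑' m, qGaussTerm A B q (x * q ^ N) m := by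
    intro N
    induction N with
    | zero => simp [qShifted]
    | succ N ih =>
      have c := tsum_qGaussTerm_contiguous hq (hxN N) (hN N)
      rw [mul_assoc x _ q, ← pow_succ] at c
      simp only [qShifted_succ]
      linear_combination (1 - x * A * B * q ^ N) * (1 - x * q ^ N) * ih
        + qShifted (x * A) q N * qShifted (x * B) q N * c
  have lim : Tendsto (fun N => ∑' m, qGaussTerm A B q (x * q ^ N) m) atTop (𝓝 1) := by
    obtain ⟨M, hM, HM⟩ := exists_norm_qGaussTerm_le hq h
    have hsum := summable_geometric_of_lt_one (norm_nonneg x) hx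
    have : Tendsto (fun N => ∑' m, qGaussTerm A B q (x * q ^ N) m) atTop
        (𝓝 (∑' m, if m = 0 then (1 : ℂ) else 0)) := by
      refine tendsto_tsum_of_dominated_convergence (hsum.mul_left M) (fun m => ?_)
        (Eventually.of_forall fun N m => (HM N m).trans ?_)
      · rcases Nat.eq_zero_or_pos m with rfl | hm
        · simp [qGaussTerm, qShifted]
        · rw [if_neg hm.ne']
          refine squeeze_zero_norm (fun N => HM N m) ?_
          have hp := (tendsto_pow_atTop_nhds_zero_of_norm_lt_one hq).const_mul x
          simpa [hm.ne'] using ((hp.norm.pow m).const_mul M)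
      · gcongr
        rw [norm_mul, norm_pow]
        exact mul_le_of_le_one_right (norm_nonneg x) (pow_le_one₀ (norm_nonneg q) hq.le)
    simpa using this
  have hlim := tendsto_nhds_unique
    (((tendsto_qShifted (x * A * B) q hq).mul (tendsto_qShifted x q hq)).mul_const
      (∑' m, qGaussTerm A B q x m))
    ((((tendsto_qShifted (x * A) q hq).mul (tendsto_qShifted (x * B) q hq)).mul lim).congr
      fun N => (iter N).symm)
  rw [eq_div_iff (mul_ne_zero (qShiftedInf_ne_zero hq h)
    (qShiftedInf_ne_zero hq (mul_pow_ne_one_of_norm_lt hx hq))), mul_comm, hlim, mul_one]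

/-! ### The terminating `₆φ₅` summation -/

/-- The very-well-poised factor `(1 - t p^{2r}) / (1 - t) * (t; p)_r / (p; p)_r`, with the
factor `1 - t` cancelled. -/
noncomputable def wellPoised (t p : ℂ) : ℕ → ℂ
  | 0 => 1
  | r + 1 => (1 - t * p ^ (2 * (r + 1))) * qShifted (t * p) p r / qShifted p p (r + 1)

/-- The homogeneous shifted factorial `∏_{k < r} (Z - p^k)`. -/
noncomputable def qFalling (Z p : ℂ) (r : ℕ) : ℂ :=
  ∏ k ∈ range r, (Z - p ^ k)

/-- `qFalling Z p r` is Z^r (1/Z;p)_r, so using X, Y, Z for the inverses of the usual parameters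
avoids division, and Z = p^n terminates the series. -/
theorem qFalling_succ (Z p : ℂ) (r : ℕ) :
    qFalling Z p (r + 1) = qFalling Z p r * (Z - p ^ r) :=
  Finset.prod_range_succ _ _

theorem qFalling_mul_succ (Z p : ℂ) (r : ℕ) :
    qFalling (p * Z) p (r + 1) = (p * Z - 1) * (p ^ r * qFalling Z p r) := by
  rw [qFalling, Finset.prod_range_succ', mul_comm, pow_zero, qFalling]
  congr 1
  rw [← Finset.card_range r, ← Finset.prod_const, Finset.card_range, ← Finset.prod_mul_distrib]
  exact Finset.prod_congr rfl fun k _ => by ring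

theorem qFalling_pow_self (p : ℂ) {n r : ℕ} (h : n < r) : qFalling (p ^ n) p r = 0 :=
  Finset.prod_eq_zero (Finset.mem_range.2 h) (sub_self _)

/-- The part of the `₆φ₅` term that depends on the three free parameters. -/
noncomputable def sixPhiFiveCore (t p X Y Z : ℂ) (r : ℕ) : ℂ :=
  (t * p) ^ r * qFalling X p r * qFalling Y p r * qFalling Z p r
    / (qShifted (t * p * X) p r * qShifted (t * p * Y) p r * qShifted (t * p * Z) p r)

/-- An antidifference for the `Z`-contiguous relation of the very-well-poised `₆φ₅` series. -/
noncomputable def sixPhiFiveAnti (t p X Y Z : ℂ) : ℕ → ℂ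
  | 0 => 0
  | r + 1 => (1 - t * p * Z) * (p * Z) * t * qShifted (t * p) p r / qShifted p p r
      * sixPhiFiveCore t p X Y Z r * (X - p ^ r) * (Y - p ^ r) / (1 - t * p * Z * p ^ r)

theorem sixPhiFive_telescope {t p X Y Z : ℂ}
    (hp : ∀ k : ℕ, p * p ^ k ≠ 1)
    (hX : ∀ k : ℕ, t * p * X * p ^ k ≠ 1) (hY : ∀ k : ℕ, t * p * Y * p ^ k ≠ 1)
    (hZ : ∀ k : ℕ, t * p * Z * p ^ k ≠ 1) (r : ℕ) :
    (1 - t * p * X * Z) * (1 - t * p * Y * Z)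
          * (wellPoised t p r * sixPhiFiveCore t p X Y (p * Z) r)
        - (1 - t * p * Z) * (1 - t * p * X * Y * Z)
          * (wellPoised t p r * sixPhiFiveCore t p X Y Z r)
      = sixPhiFiveAnti t p X Y Z (r + 1) - sixPhiFiveAnti t p X Y Z r := by
  have hZ0 : 1 - t * p * Z ≠ 0 := by simpa using sub_ne_zero.2 (hZ 0).symm
  cases r with
  | zero =>
    simp [wellPoised, sixPhiFiveAnti, sixPhiFiveCore, qShifted, qFalling]
    field_simp
    ring
  | succ s =>
    have hP := qShifted_ne_zero hp s
    have hXs := qShifted_ne_zero hX s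
    have hYs := qShifted_ne_zero hY s
    have hZs := qShifted_ne_zero hZ s
    have hX1 : 1 - t * p * X * p ^ s ≠ 0 := sub_ne_zero.2 (hX s).symm
    have hY1 : 1 - t * p * Y * p ^ s ≠ 0 := sub_ne_zero.2 (hY s).symm
    have hZ1 : 1 - t * p * Z * p ^ s ≠ 0 := sub_ne_zero.2 (hZ s).symm
    have hZ2 : 1 - t * p * Z * (p * p ^ s) ≠ 0 := by
      rw [← pow_succ']; exact sub_ne_zero.2 (hZ (s + 1)).symm
    have hp1 : 1 - p * p ^ s ≠ 0 := sub_ne_zero.2 (hp s).symm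
    have e : qShifted (t * p * (p * Z)) p (s + 1)
        = qShifted (t * p * Z) p s * (1 - t * p * Z * p ^ s) * (1 - t * p * Z * (p * p ^ s))
          / (1 - t * p * Z) := by
      rw [eq_div_iff hZ0, ← pow_succ', ← qShifted_succ, ← qShifted_succ, qShifted_succ' _ _ (s + 1),
        mul_comm, show t * p * Z * p = t * p * (p * Z) by ring]
    have e2 : p ^ (2 * (s + 1)) = (p * p ^ s) ^ 2 := by ring
    simp only [wellPoised, sixPhiFiveAnti, sixPhiFiveCore, e, e2, qFalling_mul_succ]
    simp only [qShifted_succ, qFalling_succ, pow_succ' _ s]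
    generalize p ^ s = y at *
    generalize (t * p) ^ s = u at *
    generalize qShifted (t * p) p s = a0 at *
    generalize qShifted p p s = a1 at *
    generalize qShifted (t * p * X) p s = a2 at *
    generalize qShifted (t * p * Y) p s = a3 at *
    generalize qShifted (t * p * Z) p s = a4 at *
    generalize qFalling X p s = b1 at *
    generalize qFalling Y p s = b2 at *
    generalize qFalling Z p s = b3 at *
    generalize hd : 1 - t * p * Z * (p * y) = d at *
    field_simp
    rw [← hd]
    ring

/-- The terminating very-well-poised `₆φ₅` summation. -/
theorem sum_sixPhiFive {t p X Y : ℂ}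
    (hp : ∀ k : ℕ, p * p ^ k ≠ 1) (ht : ∀ k : ℕ, t * p * p ^ k ≠ 1)
    (hX : ∀ k : ℕ, t * p * X * p ^ k ≠ 1) (hY : ∀ k : ℕ, t * p * Y * p ^ k ≠ 1) (n : ℕ) :
    qShifted (t * p * X) p n * qShifted (t * p * Y) p n
        * ∑ r ∈ range (n + 1), wellPoised t p r * sixPhiFiveCore t p X Y (p ^ n) r
      = qShifted (t * p) p n * qShifted (t * p * X * Y) p n := by
  induction n with
  | zero => simp [qShifted, wellPoised, sixPhiFiveCore, qFalling]
  | succ n ih =>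
    have hZ : ∀ k : ℕ, t * p * p ^ n * p ^ k ≠ 1 := fun k => by
      rw [mul_assoc _ (p ^ n), ← pow_add]; exact ht _
    have tel := Finset.sum_congr rfl fun r (_ : r ∈ range (n + 2)) =>
      sixPhiFive_telescope hp hX hY hZ r
    -- This removes both the extra term of the sum at Z = p^n and the upper boundary term of the
    -- telescoping.
    have h0 : sixPhiFiveCore t p X Y (p ^ n) (n + 1) = 0 := by
      simp [sixPhiFiveCore, qFalling_pow_self p (Nat.lt_succ_self n)]
    rw [Finset.sum_range_sub, Finset.sum_sub_distrib, ← Finset.mul_sum, ← Finset.mul_sum,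
      Finset.sum_range_succ (fun r => wellPoised t p r * sixPhiFiveCore t p X Y (p ^ n) r),
      sixPhiFiveAnti, sixPhiFiveAnti, h0, ← pow_succ'] at tel
    simp only [qShifted_succ]
    linear_combination qShifted (t * p * X) p n * qShifted (t * p * Y) p n * tel
      + (1 - t * p * p ^ n) * (1 - t * p * X * Y * p ^ n) * ih

/-! ### The cubic Bailey pair -/

section CubeRoots

variable {ω : ℂ}

theorem qShifted_mul_cubeRoots (h : 1 + ω + ω ^ 2 = 0) (x p : ℂ) (n : ℕ) :
    qShifted (x * ω) p n * qShifted (x * ω ^ 2) p n * qShifted x p n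
      = qShifted (x ^ 3) (p ^ 3) n := by
  simp only [qShifted, ← Finset.prod_mul_distrib]
  refine Finset.prod_congr rfl fun k _ => ?_
  have e : (p ^ 3) ^ k = (p ^ k) ^ 3 := by ring
  rw [e]
  generalize p ^ k = y
  linear_combination (-(x * y) + (x * y) ^ 2 * ω - (x * y) ^ 3 * (ω - 1)) * h

theorem qFalling_mul_cubeRoots (h : 1 + ω + ω ^ 2 = 0) (Z p : ℂ) (n : ℕ) :
    qFalling (ω * Z) p n * qFalling (ω ^ 2 * Z) p n * qFalling Z p n
      = qFalling (Z ^ 3) (p ^ 3) n := by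
  simp only [qFalling, ← Finset.prod_mul_distrib]
  refine Finset.prod_congr rfl fun k _ => ?_
  have e : (p ^ 3) ^ k = (p ^ k) ^ 3 := by ring
  rw [e]
  generalize p ^ k = y
  linear_combination (Z * y ^ 2 - Z ^ 2 * y * ω + Z ^ 3 * (ω - 1)) * h

end CubeRoots

theorem choose_succ_two (r : ℕ) : (r + 1).choose 2 = r + r.choose 2 := by
  rw [Nat.choose_succ_succ' r 1, Nat.choose_one_right]

/-- Converts the factor 1/(q;q)_{n-r} of a Bailey pair, n = m + r, into the numerator parameter
q^{-n} of a terminating series. -/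
theorem qFalling_pow_add_mul (q : ℂ) (m r : ℕ) :
    qFalling (q ^ (m + r)) q r * qShifted q q m
      = (-1) ^ r * q ^ r.choose 2 * qShifted q q (m + r) := by
  induction r with
  | zero => simp [qFalling]
  | succ r ih =>
    rw [← add_assoc, pow_succ', qFalling_mul_succ, qShifted_succ, choose_succ_two, pow_add _ r]
    generalize qFalling (q ^ (m + r)) q r = f at *
    linear_combination (q * q ^ (m + r) - 1) * q ^ r * ih

/-- The sequence `α_r` of the cubic Bailey pair relative to `t ^ 3`, in base `p ^ 3`. -/
noncomputable def cubicBaileyAlpha (t p : ℂ) (r : ℕ) : ℂ :=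
  (-1) ^ r * wellPoised t p r * (t * p) ^ r * (p ^ 3) ^ r.choose 2

theorem cubicBaileyPair {t p : ℂ} (hp : ‖p ^ 3‖ < 1)
    (h : ∀ k : ℕ, t ^ 3 * p ^ 3 * (p ^ 3) ^ k ≠ 1) (n : ℕ) :
    ∑ rm ∈ antidiagonal n, cubicBaileyAlpha t p rm.1
        / (qShifted (p ^ 3) (p ^ 3) rm.2 * qShifted (t ^ 3 * p ^ 3) (p ^ 3) (2 * rm.1 + rm.2))
      = qShifted (t * p) p (3 * n)
        / (qShifted (p ^ 3) (p ^ 3) n * qShifted (t ^ 3 * p ^ 3) (p ^ 3) (2 * n)) := by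
  obtain ⟨ω, hω⟩ : ∃ ω : ℂ, 1 + ω + ω ^ 2 = 0 := by
    have := (Complex.isPrimitiveRoot_exp 3 (by norm_num)).geom_sum_eq_zero (by norm_num)
    simp only [Finset.sum_range_succ, Finset.sum_range_zero, pow_zero, pow_one, zero_add] at this
    exact ⟨_, this⟩
  have hω3 : ω ^ 3 = 1 := by linear_combination (ω - 1) * hω
  have hq := mul_pow_ne_one_of_norm_lt hp hp
  have hp1 : ∀ k : ℕ, p * p ^ k ≠ 1 := fun k e => hq k <| by
    rw [show p ^ 3 * (p ^ 3) ^ k = (p * p ^ k) ^ 3 by ring, e, one_pow]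
  have ht1 : ∀ k : ℕ, t * p * p ^ k ≠ 1 := fun k e => h k <| by
    rw [show t ^ 3 * p ^ 3 * (p ^ 3) ^ k = (t * p * p ^ k) ^ 3 by ring, e, one_pow]
  -- The cube of the left side is t^3 p^3 (p^3)^(n+k), which `h` keeps away from 1.
  have hc : ∀ c : ℂ, c ^ 3 = 1 → ∀ k : ℕ, t * p * (c * p ^ n) * p ^ k ≠ 1 :=
    fun c hc k e => h (n + k) <| by
      have e3 : (t * p * (c * p ^ n) * p ^ k) ^ 3 = 1 := by rw [e, one_pow]
      linear_combination e3 - t ^ 3 * p ^ 3 * (p ^ 3) ^ (n + k) * hc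
  -- The parameters are X = ωp^n, Y = ω²p^n, Z = p^n.
  have key := sum_sixPhiFive hp1 ht1 (hc ω hω3)
    (hc (ω ^ 2) (by rw [← pow_mul, mul_comm, pow_mul, hω3, one_pow])) n
  have core : ∀ r, sixPhiFiveCore t p (ω * p ^ n) (ω ^ 2 * p ^ n) (p ^ n) r
      = (t * p) ^ r * qFalling ((p ^ 3) ^ n) (p ^ 3) r
        / qShifted (t ^ 3 * p ^ 3 * (p ^ 3) ^ n) (p ^ 3) r := fun r => by
    rw [sixPhiFiveCore, mul_assoc ((t * p) ^ r), mul_assoc ((t * p) ^ r),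
      qFalling_mul_cubeRoots hω,
      show t * p * (ω * p ^ n) = t * p * p ^ n * ω by ring,
      show t * p * (ω ^ 2 * p ^ n) = t * p * p ^ n * ω ^ 2 by ring,
      qShifted_mul_cubeRoots hω,
      show (t * p * p ^ n) ^ 3 = t ^ 3 * p ^ 3 * (p ^ 3) ^ n by ring,
      show (p ^ n) ^ 3 = (p ^ 3) ^ n by ring]
  -- Since ω^3 = 1, the last factor of the `₆φ₅` evaluation starts at t p p^{2n}: it is the final
  -- third of (tp;p)_{3n}.
  have h3n : qShifted (t * p) p (3 * n) = qShifted (t * p) p n * qShifted (t * p * p ^ n) p n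
      * qShifted (t * p * (ω * p ^ n) * (ω ^ 2 * p ^ n)) p n := by
    rw [show t * p * (ω * p ^ n) * (ω ^ 2 * p ^ n) = t * p * p ^ (n + n) * ω ^ 3 by ring, hω3,
      mul_one, ← qShifted_add, ← qShifted_add, show 3 * n = n + n + n by ring]
  have hprod : qShifted (t * p * (ω * p ^ n)) p n * qShifted (t * p * (ω ^ 2 * p ^ n)) p n
      * qShifted (t * p * p ^ n) p n = qShifted (t ^ 3 * p ^ 3 * (p ^ 3) ^ n) (p ^ 3) n := by
    rw [show t * p * (ω * p ^ n) = t * p * p ^ n * ω by ring,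
      show t * p * (ω ^ 2 * p ^ n) = t * p * p ^ n * ω ^ 2 by ring,
      qShifted_mul_cubeRoots hω,
      show (t * p * p ^ n) ^ 3 = t ^ 3 * p ^ 3 * (p ^ 3) ^ n by ring]
  have hQn := qShifted_ne_zero hq n
  have hAn := qShifted_ne_zero h n
  have hA2 := qShifted_ne_zero h (2 * n)
  have hsum : ∑ rm ∈ antidiagonal n, cubicBaileyAlpha t p rm.1
        / (qShifted (p ^ 3) (p ^ 3) rm.2 * qShifted (t ^ 3 * p ^ 3) (p ^ 3) (2 * rm.1 + rm.2))
      = (∑ r ∈ range (n + 1), wellPoised t p r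
          * sixPhiFiveCore t p (ω * p ^ n) (ω ^ 2 * p ^ n) (p ^ n) r)
        / (qShifted (p ^ 3) (p ^ 3) n * qShifted (t ^ 3 * p ^ 3) (p ^ 3) n) := by
    rw [Finset.sum_div, ← Finset.Nat.sum_antidiagonal_eq_sum_range_succ_mk
      (f := fun rm => wellPoised t p rm.1
        * sixPhiFiveCore t p (ω * p ^ n) (ω ^ 2 * p ^ n) (p ^ n) rm.1
        / (qShifted (p ^ 3) (p ^ 3) n * qShifted (t ^ 3 * p ^ 3) (p ^ 3) n))]
    refine Finset.sum_congr rfl fun rm hrm => ?_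
    obtain ⟨r, m⟩ := rm
    obtain rfl : r + m = n := Finset.HasAntidiagonal.mem_antidiagonal.1 hrm
    dsimp only
    have hf := qFalling_pow_add_mul (p ^ 3) m r
    rw [add_comm m r] at hf
    have hQm := qShifted_ne_zero hq m
    have e2 : qShifted (t ^ 3 * p ^ 3) (p ^ 3) (2 * r + m)
        = qShifted (t ^ 3 * p ^ 3) (p ^ 3) (r + m)
          * qShifted (t ^ 3 * p ^ 3 * (p ^ 3) ^ (r + m)) (p ^ 3) r := by
      rw [← qShifted_add]; congr 1; ring
    have h2 := qShifted_ne_zero h (2 * r + m)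
    rw [e2] at h2 ⊢
    have h2' := right_ne_zero_of_mul h2
    rw [core, cubicBaileyAlpha, mul_div_assoc', div_div,
      div_eq_div_iff (mul_ne_zero hQm h2) (mul_ne_zero h2' (mul_ne_zero hQn hAn))]
    linear_combination (-wellPoised t p r * (t * p) ^ r
      * qShifted (t ^ 3 * p ^ 3) (p ^ 3) (r + m)
      * qShifted (t ^ 3 * p ^ 3 * (p ^ 3) ^ (r + m)) (p ^ 3) r) * hf
  rw [hsum, h3n, div_eq_div_iff (mul_ne_zero hQn hAn) (mul_ne_zero hQn hA2), two_mul n,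
    qShifted_add, ← hprod]
  linear_combination qShifted (t * p * p ^ n) p n * qShifted (p ^ 3) (p ^ 3) n
    * qShifted (t ^ 3 * p ^ 3) (p ^ 3) n * key

/-! ### Bailey's lemma -/

theorem bailey_lemma {A B q x : ℂ} (hq : ‖q‖ < 1) (hx : ‖x‖ < 1)
    (hAB : ∀ k : ℕ, x * A * B * q ^ k ≠ 1) (hA : ∀ k : ℕ, x * A * q ^ k ≠ 1)
    (hB : ∀ k : ℕ, x * B * q ^ k ≠ 1) {u β : ℕ → ℂ} (hu : Summable fun r => u r * x ^ r)
    (hβ : ∀ n, ∑ rm ∈ antidiagonal n, u rm.1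
      / (qShifted q q rm.2 * qShifted (x * A * B) q (2 * rm.1 + rm.2)) = β n) :
    Summable (fun n => qShifted A q n * qShifted B q n * x ^ n * β n) ∧
    Summable (fun r => qShifted A q r * qShifted B q r * x ^ r * u r
      / (qShifted (x * A) q r * qShifted (x * B) q r)) ∧
    qShiftedInf (x * A * B) q * qShiftedInf x q / (qShiftedInf (x * A) q * qShiftedInf (x * B) q)
        * ∑' n, qShifted A q n * qShifted B q n * x ^ n * β n
      = ∑' r, qShifted A q r * qShifted B q r * x ^ r * u r
        / (qShifted (x * A) q r * qShifted (x * B) q r) := by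
  set K := qShiftedInf (x * A * B) q * qShiftedInf x q
    / (qShiftedInf (x * A) q * qShiftedInf (x * B) q) with hK
  set F : ℕ × ℕ → ℂ := fun rm => qShifted A q (rm.1 + rm.2) * qShifted B q (rm.1 + rm.2)
    * x ^ (rm.1 + rm.2)
    * (u rm.1 / (qShifted q q rm.2 * qShifted (x * A * B) q (2 * rm.1 + rm.2))) with hF
  have hABi := qShiftedInf_ne_zero hq hAB
  have hAi := qShiftedInf_ne_zero hq hA
  have hBi := qShiftedInf_ne_zero hq hB
  have hxi := qShiftedInf_ne_zero hq (mul_pow_ne_one_of_norm_lt hx hq)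
  -- All shifted factorials and their inverses are bounded, so F is dominated by a multiple of |u_r
  -- x^r| |x|^m; this justifies the exchange of sums.
  have hFs : Summable F := by
    obtain ⟨M₁, h₁, H₁⟩ := exists_norm_qShifted_le A hq
    obtain ⟨M₂, h₂, H₂⟩ := exists_norm_qShifted_le B hq
    obtain ⟨M₃, h₃, H₃⟩ := exists_norm_inv_qShifted_le hq (mul_pow_ne_one_of_norm_lt hq hq)
    obtain ⟨M₄, h₄, H₄⟩ := exists_norm_inv_qShifted_le hq hAB
    have hs := (hu.norm.mul_of_nonneg (summable_geometric_of_lt_one (norm_nonneg x) hx)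
      (fun _ => norm_nonneg _) (fun _ => by positivity)).mul_left (M₁ * M₂ * (M₃ * M₄))
    refine Summable.of_norm_bounded hs fun rm => ?_
    have e : F rm = qShifted A q (rm.1 + rm.2) * qShifted B q (rm.1 + rm.2)
        * ((qShifted q q rm.2)⁻¹ * (qShifted (x * A * B) q (2 * rm.1 + rm.2))⁻¹)
        * (u rm.1 * x ^ rm.1 * x ^ rm.2) := by
      simp only [hF, div_eq_mul_inv, mul_inv, pow_add]; ring
    rw [e]
    simp only [norm_mul, norm_pow]
    gcongr
    exacts [H₁ _, H₂ _, H₃ _, H₄ _]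
  -- `q`-Gauss with A q^r, B q^r and the same x; the shifted infinite products recombine with K.
  have inner : ∀ r, K * ∑' m, F (r, m) = qShifted A q r * qShifted B q r * x ^ r * u r
      / (qShifted (x * A) q r * qShifted (x * B) q r) := by
    intro r
    have hG : ∀ k : ℕ, x * (A * q ^ r) * (B * q ^ r) * q ^ k ≠ 1 := fun k => by
      have := hAB (2 * r + k)
      rwa [show x * A * B * q ^ (2 * r + k) = x * (A * q ^ r) * (B * q ^ r) * q ^ k by ring] at this
    have eF : ∀ m, F (r, m) = qShifted A q r * qShifted B q r * x ^ r * u r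
        / qShifted (x * A * B) q (2 * r) * qGaussTerm (A * q ^ r) (B * q ^ r) q x m := fun m => by
      simp only [hF, qGaussTerm, qShifted_add, pow_add]
      rw [show x * (A * q ^ r) * (B * q ^ r) = x * A * B * q ^ (2 * r) by ring]
      simp only [div_eq_mul_inv, mul_inv]
      ring
    simp only [eF]
    rw [tsum_mul_left, tsum_qGaussTerm hq hx hG, hK,
      show x * (A * q ^ r) * (B * q ^ r) = x * A * B * q ^ (2 * r) by ring, ← mul_assoc x A,
      ← mul_assoc x B]
    rw [qShiftedInf_eq_mul hq r] at hAi hBi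
    rw [qShiftedInf_eq_mul hq (2 * r)] at hABi
    rw [qShiftedInf_eq_mul hq (2 * r) (a := x * A * B), qShiftedInf_eq_mul hq r (a := x * A),
      qShiftedInf_eq_mul hq r (a := x * B)]
    obtain ⟨hA1, hA2⟩ := mul_ne_zero_iff.1 hAi
    obtain ⟨hB1, hB2⟩ := mul_ne_zero_iff.1 hBi
    obtain ⟨hC1, hC2⟩ := mul_ne_zero_iff.1 hABi
    field_simp
  have outer : ∀ n, ∑' rm : antidiagonal n, F rm.1
      = qShifted A q n * qShifted B q n * x ^ n * β n := fun n => by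
    rw [tsum_fintype, Finset.univ_eq_attach, Finset.sum_attach _ F, ← hβ, Finset.mul_sum]
    refine Finset.sum_congr rfl fun rm hrm => ?_
    simp only [hF, Finset.HasAntidiagonal.mem_antidiagonal.1 hrm]
  have hσ := (Finset.HasAntidiagonal.sigmaAntidiagonalEquivProd (A := ℕ)).summable_iff.2 hFs
  have s1 : Summable (fun n => qShifted A q n * qShifted B q n * x ^ n * β n) :=
    hσ.sigma.congr outer
  have s2 := (hFs.prod.mul_left K).congr inner
  refine ⟨s1, s2, ?_⟩
  rw [← tsum_congr inner, tsum_mul_left, ← hFs.tsum_prod, ← tsum_congr outer,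
    ← (Finset.HasAntidiagonal.sigmaAntidiagonalEquivProd (A := ℕ)).tsum_eq F]
  congr 1
  exact hσ.tsum_sigma.symm

/-! ### Convergence and specialisation -/

/-- The ratio of consecutive terms is c q^r, which tends to 0 whatever c is. -/
theorem summable_pow_mul_pow_choose_two (c : ℂ) {q : ℂ} (hq : ‖q‖ < 1) :
    Summable fun r : ℕ => c ^ r * q ^ r.choose 2 := by
  have hlim : Tendsto (fun r : ℕ => ‖c * q ^ r‖) atTop (𝓝 0) := by
    simpa using ((tendsto_pow_atTop_nhds_zero_of_norm_lt_one hq).const_mul c).norm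
  refine summable_of_ratio_norm_eventually_le (r := 1 / 2) (by norm_num) ?_
  filter_upwards [hlim.eventually (ge_mem_nhds (by norm_num : (0 : ℝ) < 1 / 2))] with r hr
  rw [choose_succ_two, show c ^ (r + 1) * q ^ (r + r.choose 2)
    = c * q ^ r * (c ^ r * q ^ r.choose 2) by ring, norm_mul]
  gcongr

theorem exists_norm_wellPoised_le (t : ℂ) {p : ℂ} (hp : ‖p‖ < 1) :
    ∃ M : ℝ, ∀ r, ‖wellPoised t p r‖ ≤ M := by
  have h1 : Tendsto (fun r => wellPoised t p (r + 1)) atTop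
      (𝓝 ((1 - t * 0) * qShiftedInf (t * p) p / qShiftedInf p p)) := by
    have hpow : Tendsto (fun r : ℕ => p ^ (2 * (r + 1))) atTop (𝓝 0) :=
      (tendsto_pow_atTop_nhds_zero_of_norm_lt_one hp).comp <|
        tendsto_atTop_mono (fun r => by dsimp only [id]; omega) tendsto_id
    exact (((hpow.const_mul t).const_sub 1).mul (tendsto_qShifted _ _ hp)).div
      ((tendsto_qShifted p p hp).comp (tendsto_add_atTop_nat 1))
      (qShiftedInf_ne_zero hp (mul_pow_ne_one_of_norm_lt hp hp))
  obtain ⟨M, -, hM⟩ := exists_norm_le_of_tendsto ((tendsto_add_atTop_iff_nat 1).1 h1)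
  exact ⟨M, hM⟩

theorem summable_cubicBaileyAlpha_mul_pow (t x : ℂ) {p : ℂ} (hp : ‖p‖ < 1)
    (hp3 : ‖p ^ 3‖ < 1) : Summable fun r => cubicBaileyAlpha t p r * x ^ r := by
  obtain ⟨M, hM⟩ := exists_norm_wellPoised_le t hp
  refine Summable.of_norm_bounded
    ((summable_pow_mul_pow_choose_two (t * p * x) hp3).norm.mul_left M) fun r => ?_
  have e : cubicBaileyAlpha t p r * x ^ r
      = (-1) ^ r * (wellPoised t p r * ((t * p * x) ^ r * (p ^ 3) ^ r.choose 2)) := by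
    rw [cubicBaileyAlpha]; ring
  rw [e, norm_mul, norm_mul, norm_pow, norm_neg, norm_one, one_pow, one_mul]
  gcongr
  exact hM r

theorem wellPoised_of_ne_one {t : ℂ} (p : ℂ) (ht : t ≠ 1) (r : ℕ) :
    wellPoised t p r
      = (1 - t * p ^ (2 * r)) / (1 - t) * (qShifted t p r / qShifted p p r) := by
  have h : 1 - t ≠ 0 := sub_ne_zero.2 ht.symm
  cases r with
  | zero => simp [wellPoised, qShifted, h]
  | succ r =>
    rw [wellPoised, qShifted_succ' t]
    field_simp

theorem wellPoised_one {p : ℂ} (hp : ‖p‖ < 1) (r : ℕ) :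
    wellPoised 1 p r = if r = 0 then 1 else 1 + p ^ r := by
  cases r with
  | zero => simp [wellPoised]
  | succ r =>
    have hQ := qShifted_ne_zero (mul_pow_ne_one_of_norm_lt hp hp) (r + 1)
    rw [wellPoised, if_neg r.succ_ne_zero, div_eq_iff hQ, qShifted_succ]
    ring_nf

/-- The exponent is n + 3·C(n,2) - 3n: the first two parts come from α_n, and -3n from the q^{-n} in
x^n. -/
theorem zpow_pentagonal {p : ℂ} (hp : p ≠ 0) (n : ℕ) :
    p ^ ((3 * (n : ℤ) ^ 2 - 7 * (n : ℤ)) / 2)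
      = p ^ n * (p ^ 3) ^ n.choose 2 / (p ^ 3) ^ n := by
  have hc : 2 * (n.choose 2 : ℤ) = (n : ℤ) ^ 2 - n := by
    induction n with
    | zero => simp
    | succ n ih => rw [choose_succ_two]; push_cast; linear_combination ih
  have e : (3 * (n : ℤ) ^ 2 - 7 * (n : ℤ)) / 2
      = ((n + 3 * n.choose 2 : ℕ) : ℤ) - ((3 * n : ℕ) : ℤ) := by
    rw [show 3 * (n : ℤ) ^ 2 - 7 * (n : ℤ)
      = 2 * (((n + 3 * n.choose 2 : ℕ) : ℤ) - ((3 * n : ℕ) : ℤ)) by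
        push_cast; linear_combination (-3) * hc]
    exact Int.mul_ediv_cancel_left _ two_ne_zero
  rw [e, zpow_sub₀ hp, zpow_natCast, zpow_natCast, pow_add, pow_mul, pow_mul]

theorem pow_mul_cubicBaileyAlpha {p : ℂ} (hp : p ≠ 0) (t a b : ℂ) (n : ℕ) :
    (t ^ 3 * a * b / p ^ 3) ^ n * cubicBaileyAlpha t p n
      = (-1) ^ n * wellPoised t p n * t ^ (4 * n) * a ^ n * b ^ n
        * p ^ ((3 * (n : ℤ) ^ 2 - 7 * (n : ℤ)) / 2) := by
  rw [zpow_pentagonal hp, cubicBaileyAlpha, div_pow, mul_pow, mul_pow, mul_pow, pow_mul t 4,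
    show t ^ 4 = t ^ 3 * t by ring, mul_pow]
  ring

/-- Here `q3` and `α3` are arbitrary cube roots `q^{1/3}` and `α^{1/3}`. The exponent
`(3 n ^ 2 - 7 n) / 2` of `q3` is an exact integer division, as `3 n ^ 2 - 7 n` is always even, so
that `q3 ^ ((3 n ^ 2 - 7 n) / 2)` is `q^{(3 n ^ 2 - 7 n) / 6}`. The last part is the case
`α^{1/3} = 1`, in which the factor
`(1 - α^{1/3} q^{2n/3}) / (1 - α^{1/3}) * (α^{1/3}; q^{1/3})_n / (q^{1/3}; q^{1/3})_n` is read as its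
limit, namely `1` for `n = 0` and `1 + q^{n/3}` for `n ≥ 1`. -/
theorem mainTheorem10 (q α a b q3 α3 : ℂ)
    (hq0 : q ≠ 0) (hq1 : ‖q‖ < 1) (hq3 : q3 ^ 3 = q) (hα3 : α3 ^ 3 = α)
    (ha : a ≠ 0) (hb : b ≠ 0)
    (hconv : ‖α * a * b / q‖ < 1)
    (hαq : ∀ k : ℕ, α * q * q ^ k ≠ 1)
    (hαa : ∀ k : ℕ, α * a * q ^ k ≠ 1)
    (hαb : ∀ k : ℕ, α * b * q ^ k ≠ 1) :
    Summable (fun n : ℕ =>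
      qShifted (q / a) q n * qShifted (q / b) q n * qShifted (α3 * q3) q3 (3 * n)
        / (qShifted q q n * qShifted (α * q) q (2 * n)) * (α * a * b / q) ^ n) ∧
    (α3 ≠ 1 →
      Summable (fun n : ℕ =>
        (-1) ^ n * ((1 - α3 * q3 ^ (2 * n)) / (1 - α3))
          * (qShifted (q / a) q n * qShifted (q / b) q n * qShifted α3 q3 n
              / (qShifted (α * a) q n * qShifted (α * b) q n * qShifted q3 q3 n))
          * α3 ^ (4 * n) * a ^ n * b ^ n * q3 ^ ((3 * (n : ℤ) ^ 2 - 7 * (n : ℤ)) / 2)) ∧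
      qShiftedInf (α * q) q * qShiftedInf (α * a * b / q) q
          / (qShiftedInf (α * a) q * qShiftedInf (α * b) q)
        * ∑' n : ℕ,
          qShifted (q / a) q n * qShifted (q / b) q n * qShifted (α3 * q3) q3 (3 * n)
            / (qShifted q q n * qShifted (α * q) q (2 * n)) * (α * a * b / q) ^ n
      = ∑' n : ℕ,
          (-1) ^ n * ((1 - α3 * q3 ^ (2 * n)) / (1 - α3))
            * (qShifted (q / a) q n * qShifted (q / b) q n * qShifted α3 q3 n
                / (qShifted (α * a) q n * qShifted (α * b) q n * qShifted q3 q3 n))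
            * α3 ^ (4 * n) * a ^ n * b ^ n * q3 ^ ((3 * (n : ℤ) ^ 2 - 7 * (n : ℤ)) / 2)) ∧
    (α3 = 1 →
      Summable (fun n : ℕ =>
        (-1) ^ n * (if n = 0 then 1 else 1 + q3 ^ n)
          * (qShifted (q / a) q n * qShifted (q / b) q n
              / (qShifted (α * a) q n * qShifted (α * b) q n))
          * a ^ n * b ^ n * q3 ^ ((3 * (n : ℤ) ^ 2 - 7 * (n : ℤ)) / 2)) ∧
      qShiftedInf (α * q) q * qShiftedInf (α * a * b / q) q
          / (qShiftedInf (α * a) q * qShiftedInf (α * b) q)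
        * ∑' n : ℕ,
          qShifted (q / a) q n * qShifted (q / b) q n * qShifted (α3 * q3) q3 (3 * n)
            / (qShifted q q n * qShifted (α * q) q (2 * n)) * (α * a * b / q) ^ n
      = ∑' n : ℕ,
          (-1) ^ n * (if n = 0 then 1 else 1 + q3 ^ n)
            * (qShifted (q / a) q n * qShifted (q / b) q n
                / (qShifted (α * a) q n * qShifted (α * b) q n))
            * a ^ n * b ^ n * q3 ^ ((3 * (n : ℤ) ^ 2 - 7 * (n : ℤ)) / 2)) := by

  subst hq3 hα3
  have hp0 : q3 ≠ 0 := fun h => hq0 (by rw [h]; norm_num)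
  have hp : ‖q3‖ < 1 := by
    rw [norm_pow] at hq1
    exact (pow_lt_one_iff_of_nonneg (norm_nonneg q3) three_ne_zero).1 hq1
  set x := α3 ^ 3 * a * b / q3 ^ 3 with hx
  have exA : x * (q3 ^ 3 / a) = α3 ^ 3 * b := by rw [hx]; field_simp
  have exB : x * (q3 ^ 3 / b) = α3 ^ 3 * a := by rw [hx]; field_simp
  have exAB : x * (q3 ^ 3 / a) * (q3 ^ 3 / b) = α3 ^ 3 * q3 ^ 3 := by rw [exA]; field_simp
  -- As xA = αb, xB = αa and xAB = αq, the nonvanishing conditions are exactly the given ones.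
  obtain ⟨s1, s2, e⟩ := bailey_lemma (A := q3 ^ 3 / a) (B := q3 ^ 3 / b) hq1 hconv
    (by rwa [exAB]) (by rwa [exA]) (by rwa [exB])
    (summable_cubicBaileyAlpha_mul_pow α3 x hp hq1) (by rw [exAB]; exact cubicBaileyPair hq1 hαq)
  rw [exAB, exA, exB, mul_comm (qShiftedInf (α3 ^ 3 * b) (q3 ^ 3))] at e
  rw [exA, exB] at s2
  have el : ∀ n : ℕ, qShifted (q3 ^ 3 / a) (q3 ^ 3) n * qShifted (q3 ^ 3 / b) (q3 ^ 3) n * x ^ n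
      * (qShifted (α3 * q3) q3 (3 * n)
        / (qShifted (q3 ^ 3) (q3 ^ 3) n * qShifted (α3 ^ 3 * q3 ^ 3) (q3 ^ 3) (2 * n)))
      = qShifted (q3 ^ 3 / a) (q3 ^ 3) n * qShifted (q3 ^ 3 / b) (q3 ^ 3) n
        * qShifted (α3 * q3) q3 (3 * n)
        / (qShifted (q3 ^ 3) (q3 ^ 3) n * qShifted (α3 ^ 3 * q3 ^ 3) (q3 ^ 3) (2 * n)) * x ^ n :=
    fun n => by ring
  have hpow := pow_mul_cubicBaileyAlpha hp0 α3 a b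
  simp only [← hx] at hpow
  simp only [el, mul_assoc _ (x ^ _) (cubicBaileyAlpha _ _ _), hpow] at s1 s2 e
  refine ⟨s1, fun h1 => ?_, fun h1 => ?_⟩
  · have er : ∀ n : ℕ, qShifted (q3 ^ 3 / a) (q3 ^ 3) n * qShifted (q3 ^ 3 / b) (q3 ^ 3) n
        * ((-1) ^ n * wellPoised α3 q3 n * α3 ^ (4 * n) * a ^ n * b ^ n
          * q3 ^ ((3 * (n : ℤ) ^ 2 - 7 * (n : ℤ)) / 2))
        / (qShifted (α3 ^ 3 * b) (q3 ^ 3) n * qShifted (α3 ^ 3 * a) (q3 ^ 3) n)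
        = (-1) ^ n * ((1 - α3 * q3 ^ (2 * n)) / (1 - α3))
          * (qShifted (q3 ^ 3 / a) (q3 ^ 3) n * qShifted (q3 ^ 3 / b) (q3 ^ 3) n * qShifted α3 q3 n
            / (qShifted (α3 ^ 3 * a) (q3 ^ 3) n * qShifted (α3 ^ 3 * b) (q3 ^ 3) n
              * qShifted q3 q3 n))
          * α3 ^ (4 * n) * a ^ n * b ^ n * q3 ^ ((3 * (n : ℤ) ^ 2 - 7 * (n : ℤ)) / 2) :=
      fun n => by
        rw [wellPoised_of_ne_one q3 h1]
        simp only [div_eq_mul_inv, mul_inv]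
        ring
    exact ⟨s2.congr er, e.trans (tsum_congr er)⟩
  · have er : ∀ n : ℕ, qShifted (q3 ^ 3 / a) (q3 ^ 3) n * qShifted (q3 ^ 3 / b) (q3 ^ 3) n
        * ((-1) ^ n * wellPoised α3 q3 n * α3 ^ (4 * n) * a ^ n * b ^ n
          * q3 ^ ((3 * (n : ℤ) ^ 2 - 7 * (n : ℤ)) / 2))
        / (qShifted (α3 ^ 3 * b) (q3 ^ 3) n * qShifted (α3 ^ 3 * a) (q3 ^ 3) n)
        = (-1) ^ n * (if n = 0 then 1 else 1 + q3 ^ n)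
          * (qShifted (q3 ^ 3 / a) (q3 ^ 3) n * qShifted (q3 ^ 3 / b) (q3 ^ 3) n
            / (qShifted (α3 ^ 3 * a) (q3 ^ 3) n * qShifted (α3 ^ 3 * b) (q3 ^ 3) n))
          * a ^ n * b ^ n * q3 ^ ((3 * (n : ℤ) ^ 2 - 7 * (n : ℤ)) / 2) :=
      fun n => by
        rw [h1, wellPoised_one hp, one_pow (4 * n)]
        simp only [div_eq_mul_inv, mul_inv]
        ring
    exact ⟨s2.congr er, e.trans (tsum_congr er)⟩
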